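/- A weighted graph $G=(V,E,w)$ is a finite simple undirected graph with real weights $w(e)>0$ on its edges (non-edges have weight $0$), and $n=|V|$. For $S\subseteq V$ let $w(S)$ be the total weight of the edges with exactly one endpoint in $S$. Two weighted graphs on the same vertex set are neighboring if their weights differ by at most $1$ on one pair of vertices and agree on all other pairs. A randomized algorithm $\mathcal A$ is $\varepsilon$-DP if $\Pr[\mathcal A(G)\in O]\le e^{\varepsilon}\Pr[\mathcal A(G')\in O]$ for all neighboring $G,G'$ and all sets $O$ of outcomes. For a set of terminals $R\subseteq V$ and $v\in R$, a min isolating cut of $v$ is a set $S^*_v\subseteq V$ with $S^*_v\cap R=\{v\}$ that minimizes $w(S)$ among all sets $S\subseteq V$ with $S\cap R=\{v\}$. We write $\lg$ for the logarithm to base $2$. **Theorem 1.3.** For every constant $c>0$ there are a constant $C>0$, depending only on $c$, and a randomized algorithm that is given a weighted graph $G$ with vertex set $V$, sets $R,U\subseteq V$, and parameters $\varepsilon>0$ and $\beta\in(0,1)$, and that outputs sets $\{S_v\subseteq V: v\in R\}$, such that the following holds. 1. For fixed $V,R,U,\varepsilon,\beta$ the algorithm is $\varepsilon$-DP as a function of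 $G$. 2. The output always satisfies $S_v\cap R=\{v\}$ for every $v\in R$. 3. With probability at least $1-\min\{\beta,n^{-c}\}$, the following two properties hold simultaneously. * For all min isolating cuts $S^*_v$, $v\in R$, of $G$, $$\Bigl|\sum_{v\in R}w(S_v)-\sum_{v\in R}w(S^*_v)\Bigr|\le \Delta\quad\text{and}\quad w(S_v)\le w(S^*_v)+\Delta\ \text{ for every } v\in R,\qquad\text{where } \Delta=C\cdot\frac{(n+\lg(1/\beta))\lg^2|R|}{\varepsilon}$$ (for $R=\emptyset$ there is nothing to output and $\Delta$ is read as $0$). * If $|R|\ge 2$, then for every $v\in R$ that has a min isolating cut $S^*_v$ with $|S^*_v\cap U|\le 0.5\,|U|$, we have $|S_v\cap U|\le 0.9\,|U|$. -/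

import Mathlib

universe u

/-- A weighted undirected graph `(V, E, w)` with positive edge weights. Pairs of vertices that are
not edges carry weight `0`. -/
structure WeightedGraph (V : Type*) where
  graph : SimpleGraph V
  weight : V → V → ℝ
  weight_symm : ∀ u v, weight u v = weight v u
  weight_pos : ∀ u v, graph.Adj u v → 0 < weight u v
  weight_eq_zero : ∀ u v, ¬ graph.Adj u v → weight u v = 0

/-- The value `w(S)` of the cut `(S, V \ S)`: the total weight of the edges with exactly one
endpoint in `S` (each such edge has one endpoint `u ∈ S` and one endpoint `v ∉ S`, and is
counted once). -/
def WeightedGraph.cutValue {V : Type*} [Fintype V] [DecidableEq V] (G : WeightedGraph V)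
    (S : Finset V) : ℝ :=
  ∑ u ∈ S, ∑ v ∈ Sᶜ, G.weight u v

/-- Edge-neighbouring graphs: on the same vertex set, the weights differ by at most `1` on a single
unordered pair and agree on all others. -/
def EdgeNeighboring {V : Type*} (G G' : WeightedGraph V) : Prop :=
  ∃ a b : V, |G.weight a b - G'.weight a b| ≤ 1 ∧
    ∀ u v : V, s(u, v) ≠ s(a, b) → G.weight u v = G'.weight u v

/-- A randomized algorithm with a discrete range: every input is mapped to the probability
distribution of the output. -/
abbrev RandomizedAlgorithm (X Y : Type*) := X → PMF Y

/-- `(ε, δ)`-differential privacy with respect to edge-neighbouring graphs. -/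
def IsDifferentiallyPrivate {V Y : Type*} (A : RandomizedAlgorithm (WeightedGraph V) Y)
    (ε δ : ℝ) : Prop :=
  ∀ G G' : WeightedGraph V, EdgeNeighboring G G' → ∀ O : Set Y,
    (A G).toOuterMeasure O ≤
      ENNReal.ofReal (Real.exp ε) * (A G').toOuterMeasure O + ENNReal.ofReal δ

/-- `S` isolates the terminal `r` from the other terminals in `R`. -/
def IsIsolating {V : Type*} [DecidableEq V] (R : Finset V) (r : V) (S : Finset V) : Prop :=
  S ∩ R = {r}

/-- `S` is a min isolating cut for the terminal `r` of `R`. -/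
def IsMinIsolatingCut {V : Type*} [Fintype V] [DecidableEq V] (G : WeightedGraph V)
    (R : Finset V) (r : V) (S : Finset V) : Prop :=
  IsIsolating R r S ∧ ∀ T : Finset V, IsIsolating R r T → G.cutValue S ≤ G.cutValue T

/-- The outputs `S = {S_v : v ∈ R}` that are within additive error `err` of the min isolating cuts,
both in total and for each single terminal. -/
def approxIsolatingCuts {V : Type*} [Fintype V] [DecidableEq V] (G : WeightedGraph V)
    (R : Finset V) (err : ℝ) : Set (R → Finset V) :=
  {S | ∀ S' : R → Finset V, (∀ v : R, IsMinIsolatingCut G R v (S' v)) →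
    |∑ v : R, G.cutValue (S v) - ∑ v : R, G.cutValue (S' v)| ≤ err ∧
    ∀ v : R, G.cutValue (S v) ≤ G.cutValue (S' v) + err}

/-- The outputs `S = {S_v : v ∈ R}` such that `S_v` contains at most `0.9 |U|` vertices of `U` for
every terminal `v` having a min isolating cut with at most `0.5 |U|` vertices of `U`. -/
def balancedIsolatingCuts {V : Type*} [Fintype V] [DecidableEq V] (G : WeightedGraph V)
    (R U : Finset V) : Set (R → Finset V) :=
  {S | ∀ (v : R) (T : Finset V), IsMinIsolatingCut G R v T →
    ((T ∩ U).card : ℝ) ≤ 0.5 * (U.card : ℝ) → ((S v ∩ U).card : ℝ) ≤ 0.9 * (U.card : ℝ)}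

/-!
The algorithm is a single run of the exponential mechanism over families of pairwise disjoint
isolating sets, encoded as labelings `V → Option R` fixing the terminals. There are at most
`(|R| + 1) ^ n` of them, and an edge is cut by at most two members of a disjoint family, so the
total cut value has sensitivity `2` and the mechanism loses only
`O((n log |R| + log (1 / β) + c log n) / ε)` in the total.

Two consequences of posimodularity, `w(A \ B) + w(B \ A) ≤ w(A) + w(B)`, make this sufficient. Both
rest on `Labeling.cutValue_part_replace_le`: in a disjoint family, the member at `v` may be replaced
by a min isolating cut `T` of `v`, with `T` deleted from the other members, without increasing any
cut value.

* A disjoint family of least total value consists of min isolating cuts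
  (`exists_labeling_forall_le`). Since every member of a family costs at least the minimum, an
  upper bound on the total excess bounds each individual excess too.
* The score adds a penalty to families having a member with more than `0.9 |U|` points of `U`. If
  that member sits at a terminal `v` with a min isolating cut `T`, `|T ∩ U| ≤ 0.5 |U|`, then
  replacing it by `T` removes the penalty, as all the other members are disjoint from the offending
  one (`score_replace_add_le`). So such a family is worse than the optimum by the whole penalty,
  and is chosen only with small probability.

With at most one terminal the permitted error is `0`, and the algorithm returns the whole vertex
set, whose cut value is `0`.
-/

/-! ### The exponential mechanism -/

/-- The exponential mechanism on a finite type: `l` is drawn with probability proportional to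
`exp (-η * s l)`, so that small scores are preferred. -/
noncomputable def expMechanism {L : Type*} [Fintype L] [Nonempty L] (η : ℝ) (s : L → ℝ) : PMF L :=
  PMF.ofFintype (fun l => ENNReal.ofReal (Real.exp (-(η * s l)) / ∑ k, Real.exp (-(η * s k)))) <| by
    have hZ : 0 < ∑ k, Real.exp (-(η * s k)) :=
      Finset.sum_pos (fun _ _ => Real.exp_pos _) Finset.univ_nonempty
    rw [← ENNReal.ofReal_sum_of_nonneg (fun _ _ => by positivity), ← Finset.sum_div,
      div_self hZ.ne', ENNReal.ofReal_one]

lemma expMechanism_apply {L : Type*} [Fintype L] [Nonempty L] (η : ℝ) (s : L → ℝ) (l : L) :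
    expMechanism η s l =
      ENNReal.ofReal (Real.exp (-(η * s l)) / ∑ k, Real.exp (-(η * s k))) := rfl

/-- The factor `exp (η * D)` is lost twice: in the weight of `l` and in the normalization. -/
lemma expMechanism_apply_le {L : Type*} [Fintype L] [Nonempty L] {η D : ℝ} (hη : 0 ≤ η)
    {s s' : L → ℝ} (h : ∀ l, |s l - s' l| ≤ D) (l : L) :
    expMechanism η s l ≤ ENNReal.ofReal (Real.exp (2 * (η * D))) * expMechanism η s' l := by
  have hZ (s : L → ℝ) : 0 < ∑ k, Real.exp (-(η * s k)) :=
    Finset.sum_pos (fun _ _ => Real.exp_pos _) Finset.univ_nonempty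
  rw [expMechanism_apply, expMechanism_apply, ← ENNReal.ofReal_mul (Real.exp_pos _).le]
  apply ENNReal.ofReal_le_ofReal
  have h1 : Real.exp (-(η * s l)) ≤ Real.exp (η * D) * Real.exp (-(η * s' l)) := by
    rw [← Real.exp_add]
    apply Real.exp_le_exp.2
    nlinarith [(abs_le.1 (h l)).1]
  have h2 : ∑ k, Real.exp (-(η * s' k)) ≤ Real.exp (η * D) * ∑ k, Real.exp (-(η * s k)) := by
    rw [Finset.mul_sum]
    refine Finset.sum_le_sum fun k _ => ?_
    rw [← Real.exp_add]
    apply Real.exp_le_exp.2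
    nlinarith [(abs_le.1 (h k)).2]
  rw [← mul_div_assoc, div_le_div_iff₀ (hZ s) (hZ s'), two_mul, Real.exp_add]
  calc Real.exp (-(η * s l)) * ∑ k, Real.exp (-(η * s' k))
      ≤ (Real.exp (η * D) * Real.exp (-(η * s' l))) *
          (Real.exp (η * D) * ∑ k, Real.exp (-(η * s k))) :=
        mul_le_mul h1 h2 (hZ s').le (by positivity)
    _ = _ := by ring

lemma expMechanism_toOuterMeasure_le {L : Type*} [Fintype L] [Nonempty L] {η D : ℝ} (hη : 0 ≤ η)
    {s s' : L → ℝ} (h : ∀ l, |s l - s' l| ≤ D) (O : Set L) :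
    (expMechanism η s).toOuterMeasure O ≤
      ENNReal.ofReal (Real.exp (2 * (η * D))) * (expMechanism η s').toOuterMeasure O := by
  classical
  rw [PMF.toOuterMeasure_apply_fintype, PMF.toOuterMeasure_apply_fintype, Finset.mul_sum]
  refine Finset.sum_le_sum fun l _ => ?_
  by_cases hl : l ∈ O
  · simpa [hl] using expMechanism_apply_le hη h l
  · simp [hl]

/-- A union bound over the outcomes scoring at least `t` above `l₀`, each of which is
`exp (-η * t)` times less likely than `l₀`. -/
lemma ofReal_le_expMechanism {L : Type*} [Fintype L] [Nonempty L] {η t δ : ℝ} (hη : 0 ≤ η)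
    (s : L → ℝ) (l₀ : L) (hδ : Fintype.card L * Real.exp (-(η * t)) ≤ δ) :
    ENNReal.ofReal (1 - δ) ≤ (expMechanism η s).toOuterMeasure {l | s l < s l₀ + t} := by
  classical
  set p := expMechanism η s with hp
  have hZ : Real.exp (-(η * s l₀)) ≤ ∑ k, Real.exp (-(η * s k)) :=
    Finset.single_le_sum (f := fun k => Real.exp (-(η * s k))) (fun _ _ => (Real.exp_pos _).le)
      (Finset.mem_univ l₀)
  have hZ0 : 0 < ∑ k, Real.exp (-(η * s k)) := (Real.exp_pos _).trans_le hZ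
  have hsum : p.toOuterMeasure {l | s l < s l₀ + t} +
      p.toOuterMeasure {l | s l < s l₀ + t}ᶜ = 1 := by
    rw [PMF.toOuterMeasure_apply_fintype, PMF.toOuterMeasure_apply_fintype,
      ← Finset.sum_add_distrib, ← p.tsum_coe, tsum_fintype]
    exact Finset.sum_congr rfl fun l _ => Set.indicator_self_add_compl_apply _ _ _
  have hbad : p.toOuterMeasure {l | s l < s l₀ + t}ᶜ ≤ ENNReal.ofReal δ := by
    rw [PMF.toOuterMeasure_apply_fintype]
    calc ∑ l, ({l | s l < s l₀ + t}ᶜ).indicator p l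
        ≤ ∑ _l : L, ENNReal.ofReal (Real.exp (-(η * t))) := by
          refine Finset.sum_le_sum fun l _ => ?_
          by_cases hl : s l < s l₀ + t
          · simp [hl]
          · rw [Set.indicator_of_mem (by simpa using hl), hp, expMechanism_apply]
            apply ENNReal.ofReal_le_ofReal
            rw [div_le_iff₀ hZ0]
            refine le_trans ?_ (mul_le_mul_of_nonneg_left hZ (Real.exp_pos _).le)
            rw [← Real.exp_add]
            apply Real.exp_le_exp.2
            nlinarith
      _ = ENNReal.ofReal (Fintype.card L * Real.exp (-(η * t))) := by
          rw [Finset.sum_const, Finset.card_univ, nsmul_eq_mul,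
            ENNReal.ofReal_mul (Nat.cast_nonneg _), ENNReal.ofReal_natCast]
      _ ≤ _ := ENNReal.ofReal_le_ofReal hδ
  have hδ0 : 0 ≤ δ := le_trans (by positivity) hδ
  rw [ENNReal.ofReal_sub _ hδ0, ENNReal.ofReal_one, tsub_le_iff_right, ← hsum]
  gcongr

/-! ### Cut values -/

section Cuts

variable {V : Type*}

lemma WeightedGraph.weight_nonneg (G : WeightedGraph V) (u v : V) : 0 ≤ G.weight u v := by
  by_cases h : G.graph.Adj u v
  · exact (G.weight_pos u v h).le
  · exact (G.weight_eq_zero u v h).ge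

variable [Fintype V] [DecidableEq V]

/-- Unlike in the definition, the summand is symmetric in `u` and `v`; this is the form in which
inequalities between cut values hold summand by summand. -/
lemma WeightedGraph.cutValue_eq_sum_ite (G : WeightedGraph V) (S : Finset V) :
    G.cutValue S = 1 / 2 * ∑ u, ∑ v, G.weight u v * (if (u ∈ S ↔ v ∈ S) then 0 else 1) := by
  have h1 : G.cutValue S = ∑ u, ∑ v, G.weight u v * (if u ∈ S ∧ v ∉ S then 1 else 0) := by
    rw [WeightedGraph.cutValue, ← Finset.sum_subset (Finset.subset_univ S)
      (fun u _ hu => Finset.sum_eq_zero fun v _ => by simp [hu])]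
    refine Finset.sum_congr rfl fun u hu => ?_
    rw [← Finset.sum_subset (Finset.subset_univ Sᶜ)
      (fun v _ hv => by simp [Finset.mem_compl.not_left.1 hv])]
    exact Finset.sum_congr rfl fun v hv => by simp [hu, Finset.mem_compl.1 hv]
  have h2 : G.cutValue S = ∑ u, ∑ v, G.weight u v * (if v ∈ S ∧ u ∉ S then 1 else 0) := by
    rw [h1, Finset.sum_comm]
    exact Finset.sum_congr rfl fun u _ => Finset.sum_congr rfl fun v _ => by
      rw [G.weight_symm v u]
  have h3 : ∑ u, ∑ v, G.weight u v * (if (u ∈ S ↔ v ∈ S) then (0 : ℝ) else 1) =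
      G.cutValue S + G.cutValue S := by
    nth_rw 1 [h1]
    rw [h2, ← Finset.sum_add_distrib]
    refine Finset.sum_congr rfl fun u _ => ?_
    rw [← Finset.sum_add_distrib]
    refine Finset.sum_congr rfl fun v _ => ?_
    by_cases hu : u ∈ S <;> by_cases hv : v ∈ S <;> simp [hu, hv]
  rw [h3]
  ring

lemma WeightedGraph.cutValue_nonneg (G : WeightedGraph V) (S : Finset V) : 0 ≤ G.cutValue S :=
  Finset.sum_nonneg fun _ _ => Finset.sum_nonneg fun _ _ => G.weight_nonneg _ _

/-- Posimodularity of the cut function. -/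
lemma WeightedGraph.cutValue_sdiff_add_cutValue_sdiff_le (G : WeightedGraph V) (A B : Finset V) :
    G.cutValue (A \ B) + G.cutValue (B \ A) ≤ G.cutValue A + G.cutValue B := by
  simp only [G.cutValue_eq_sum_ite, ← mul_add, ← Finset.sum_add_distrib]
  refine mul_le_mul_of_nonneg_left (Finset.sum_le_sum fun u _ => Finset.sum_le_sum fun v _ =>
    mul_le_mul_of_nonneg_left ?_ (G.weight_nonneg u v)) (by norm_num)
  by_cases h1 : u ∈ A <;> by_cases h2 : v ∈ A <;> by_cases h3 : u ∈ B <;> by_cases h4 : v ∈ B <;>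
    simp [h1, h2, h3, h4]

/-- The ordered pairs `(a, b)` and `(b, a)` are the only ones whose weights may differ. -/
lemma EdgeNeighboring.sum_abs_sub_le {G G' : WeightedGraph V} (h : EdgeNeighboring G G') :
    ∑ u, ∑ v, |G.weight u v - G'.weight u v| ≤ 2 := by
  obtain ⟨a, b, hab, hne⟩ := h
  calc ∑ u, ∑ v, |G.weight u v - G'.weight u v|
      ≤ ∑ u, ∑ v, ((if u = a then if v = b then (1 : ℝ) else 0 else 0) +
          (if u = b then if v = a then (1 : ℝ) else 0 else 0)) := by
        refine Finset.sum_le_sum fun u _ => Finset.sum_le_sum fun v _ => ?_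
        by_cases huv : s(u, v) = s(a, b)
        · rcases Sym2.eq_iff.1 huv with ⟨rfl, rfl⟩ | ⟨rfl, rfl⟩
          · rw [if_pos rfl, if_pos rfl]
            refine hab.trans (le_add_of_nonneg_right ?_)
            positivity
          · rw [if_pos (rfl : u = u), if_pos (rfl : v = v), G.weight_symm, G'.weight_symm]
            refine hab.trans (le_add_of_nonneg_left ?_)
            positivity
        · rw [hne u v huv, sub_self, abs_zero]
          positivity
    _ = 2 := by
        simp only [Finset.sum_add_distrib, Finset.sum_ite_irrel, Finset.sum_const_zero,
          Finset.sum_ite_eq', Finset.mem_univ, if_true]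
        norm_num

end Cuts

/-! ### Disjoint families of isolating sets -/

/-- A family of pairwise disjoint sets isolating the terminals, encoded by the map that sends every
vertex to the terminal whose set contains it, or to `none` if there is none. -/
abbrev Labeling {V : Type*} (R : Finset V) : Type _ :=
  {l : V → Option R // ∀ r : R, l r = some r}

section Labelings

variable {V : Type*} [Fintype V] [DecidableEq V] {R : Finset V}

instance : Nonempty (Labeling R) :=
  ⟨⟨fun x => if h : x ∈ R then some ⟨x, h⟩ else none, fun r => by simp⟩⟩

lemma card_labeling_le : Fintype.card (Labeling R) ≤ (R.card + 1) ^ Fintype.card V := by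
  refine (Fintype.card_subtype_le _).trans (le_of_eq ?_)
  simp

/-- The member of the family at the terminal `r`. -/
def Labeling.part (l : Labeling R) (r : R) : Finset V := {x | l.1 x = some r}

lemma Labeling.mem_part {l : Labeling R} {r : R} {x : V} : x ∈ l.part r ↔ l.1 x = some r := by
  simp [Labeling.part]

lemma Labeling.isIsolating_part (l : Labeling R) (r : R) : IsIsolating R r (l.part r) := by
  ext x
  simp only [Finset.mem_inter, Labeling.mem_part, Finset.mem_singleton]
  constructor
  · rintro ⟨h, hx⟩
    have := l.2 ⟨x, hx⟩
    rw [h, Option.some_inj] at this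
    rw [this]
  · rintro rfl
    exact ⟨l.2 r, r.2⟩

lemma Labeling.disjoint_part (l : Labeling R) {r s : R} (h : r ≠ s) :
    Disjoint (l.part r) (l.part s) := by
  rw [Finset.disjoint_left]
  intro x hr hs
  rw [Labeling.mem_part] at hr hs
  exact h (Option.some_inj.1 (hr.symm.trans hs))

/-- The family in which the member at `v` is replaced by `T`, and `T` is deleted from the other
members. -/
def Labeling.replace (l : Labeling R) (v : R) (T : Finset V) (hT : IsIsolating R v T) :
    Labeling R :=
  ⟨fun x => if x ∈ T then some v else if l.1 x = some v then none else l.1 x, fun r => by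
    have hr : (r : V) ∈ T ↔ r = v := by
      have := Finset.ext_iff.1 hT r
      simp only [Finset.mem_inter, r.2, and_true, Finset.mem_singleton] at this
      rw [this, Subtype.ext_iff]
    beta_reduce
    by_cases h : r = v
    · rw [if_pos (hr.2 h), h]
    · rw [if_neg (mt hr.1 h), l.2 r, if_neg (by simpa using h)]⟩

lemma Labeling.part_replace_self (l : Labeling R) (v : R) (T : Finset V)
    (hT : IsIsolating R v T) : (l.replace v T hT).part v = T := by
  ext x
  rw [Labeling.mem_part]
  by_cases hx : x ∈ T <;> by_cases hl : l.1 x = some v <;> simp [Labeling.replace, hx, hl]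

lemma Labeling.part_replace_of_ne (l : Labeling R) {v u : R} (h : u ≠ v) (T : Finset V)
    (hT : IsIsolating R v T) : (l.replace v T hT).part u = l.part u \ T := by
  ext x
  rw [Finset.mem_sdiff, Labeling.mem_part, Labeling.mem_part]
  by_cases hx : x ∈ T
  · simp [Labeling.replace, hx, h.symm]
  · by_cases hl : l.1 x = some v <;> simp [Labeling.replace, hx, hl, h.symm]

/-- For the members at other terminals this is uncrossing: `T` minus such a member still isolates
`v`, hence costs at least as much as `T`. -/
lemma Labeling.cutValue_part_replace_le {G : WeightedGraph V} (l : Labeling R) (v : R)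
    {T : Finset V} (hT : IsMinIsolatingCut G R v T) (u : R) :
    G.cutValue ((l.replace v T hT.1).part u) ≤ G.cutValue (l.part u) := by
  by_cases h : u = v
  · subst h
    rw [Labeling.part_replace_self]
    exact hT.2 _ (l.isIsolating_part u)
  · rw [Labeling.part_replace_of_ne _ h]
    have hiso : IsIsolating R v (T \ l.part u) := by
      have hv : (v : V) ∉ l.part u := by
        rw [Labeling.mem_part, l.2 v, Option.some_inj]
        exact Ne.symm h
      have hT' : T ∩ R = {(v : V)} := hT.1
      rw [IsIsolating, Finset.sdiff_inter_right_comm, hT', Finset.sdiff_eq_self_iff_disjoint,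
        Finset.disjoint_singleton_left]
      exact hv
    linarith [hT.2 _ hiso, G.cutValue_sdiff_add_cutValue_sdiff_le (l.part u) T]

/-- The total cut value of a disjoint family. -/
def Labeling.total (G : WeightedGraph V) (l : Labeling R) : ℝ := ∑ r, G.cutValue (l.part r)

lemma exists_labeling_forall_le (G : WeightedGraph V) (R : Finset V) :
    ∃ l : Labeling R, ∀ (v : R) (T : Finset V), IsMinIsolatingCut G R v T →
      G.cutValue (l.part v) ≤ G.cutValue T := by
  obtain ⟨l, hl⟩ := Finite.exists_min (Labeling.total G (R := R))
  refine ⟨l, fun v T hT => ?_⟩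
  by_contra! hlt
  refine (hl (l.replace v T hT.1)).not_gt (Finset.sum_lt_sum
    (fun u _ => l.cutValue_part_replace_le v hT u) ⟨v, Finset.mem_univ v, ?_⟩)
  rwa [Labeling.part_replace_self]

/-- At most two members of a disjoint family separate two given vertices. -/
lemma Labeling.sum_separated_le (l : Labeling R) (x y : V) :
    ∑ r : R, (if (x ∈ l.part r ↔ y ∈ l.part r) then (0 : ℝ) else 1) ≤ 2 := by
  have key (x : V) : ∑ r : R, (if l.1 x = some r then (1 : ℝ) else 0) ≤ 1 := by
    cases h : l.1 x <;> simp
  calc ∑ r : R, (if (x ∈ l.part r ↔ y ∈ l.part r) then (0 : ℝ) else 1)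
      ≤ ∑ r : R, ((if l.1 x = some r then (1 : ℝ) else 0) +
          (if l.1 y = some r then (1 : ℝ) else 0)) := by
        refine Finset.sum_le_sum fun r _ => ?_
        simp only [Labeling.mem_part]
        by_cases h1 : l.1 x = some r <;> by_cases h2 : l.1 y = some r <;> simp [h1, h2]
    _ ≤ 2 := by
        rw [Finset.sum_add_distrib]
        linarith [key x, key y]

lemma Labeling.total_eq_sum (G : WeightedGraph V) (l : Labeling R) :
    l.total G = 1 / 2 * ∑ u, ∑ v, G.weight u v *
      ∑ r : R, (if (u ∈ l.part r ↔ v ∈ l.part r) then 0 else 1) := by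
  simp only [Labeling.total, G.cutValue_eq_sum_ite, Finset.mul_sum]
  rw [Finset.sum_comm]
  exact Finset.sum_congr rfl fun u _ => Finset.sum_comm

lemma Labeling.abs_total_sub_le {G G' : WeightedGraph V} (h : EdgeNeighboring G G')
    (l : Labeling R) : |l.total G - l.total G'| ≤ 2 := by
  rw [Labeling.total_eq_sum, Labeling.total_eq_sum, ← mul_sub, abs_mul, abs_of_pos (by norm_num)]
  have h1 : |∑ u, ∑ v, G.weight u v *
        ∑ r : R, (if (u ∈ l.part r ↔ v ∈ l.part r) then (0 : ℝ) else 1) -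
      ∑ u, ∑ v, G'.weight u v *
        ∑ r : R, (if (u ∈ l.part r ↔ v ∈ l.part r) then (0 : ℝ) else 1)| ≤
      ∑ u, ∑ v, |G.weight u v - G'.weight u v| * 2 := by
    rw [← Finset.sum_sub_distrib]
    refine (Finset.abs_sum_le_sum_abs _ _).trans (Finset.sum_le_sum fun u _ => ?_)
    rw [← Finset.sum_sub_distrib]
    refine (Finset.abs_sum_le_sum_abs _ _).trans (Finset.sum_le_sum fun v _ => ?_)
    rw [← sub_mul, abs_mul]
    refine mul_le_mul_of_nonneg_left ?_ (abs_nonneg _)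
    rw [abs_of_nonneg (Finset.sum_nonneg fun r _ => by positivity)]
    exact l.sum_separated_le u v
  simp only [← Finset.sum_mul] at h1
  linarith [h.sum_abs_sub_le]

/-! ### The penalized score -/

open Classical in
/-- The total cut value, plus `t` if some member contains more than `0.9 |U|` points of `U`. -/
noncomputable def Labeling.score (U : Finset V) (t : ℝ) (G : WeightedGraph V) (l : Labeling R) :
    ℝ :=
  l.total G + if ∃ r, 0.9 * (U.card : ℝ) < ((l.part r ∩ U).card : ℝ) then t else 0

lemma Labeling.total_le_score {U : Finset V} {t : ℝ} (ht : 0 ≤ t) (G : WeightedGraph V)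
    (l : Labeling R) : l.total G ≤ l.score U t G := by
  rw [Labeling.score]
  split_ifs <;> linarith

lemma Labeling.score_le {U : Finset V} {t : ℝ} (ht : 0 ≤ t) (G : WeightedGraph V)
    (l : Labeling R) : l.score U t G ≤ l.total G + t := by
  rw [Labeling.score]
  split_ifs <;> linarith

lemma Labeling.abs_score_sub_le {G G' : WeightedGraph V} (h : EdgeNeighboring G G')
    (U : Finset V) (t : ℝ) (l : Labeling R) : |l.score U t G - l.score U t G'| ≤ 2 := by
  rw [Labeling.score, Labeling.score, add_sub_add_right_eq_sub]
  exact l.abs_total_sub_le h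

lemma Labeling.score_replace_add_le {U : Finset V} (t : ℝ) {G : WeightedGraph V}
    (l : Labeling R) {v : R} {T : Finset V} (hT : IsMinIsolatingCut G R v T)
    (hTU : ((T ∩ U).card : ℝ) ≤ 0.5 * (U.card : ℝ))
    (hv : 0.9 * (U.card : ℝ) < ((l.part v ∩ U).card : ℝ)) :
    (l.replace v T hT.1).score U t G + t ≤ l.score U t G := by
  have hno : ¬ ∃ r, 0.9 * (U.card : ℝ) < (((l.replace v T hT.1).part r ∩ U).card : ℝ) := by
    rintro ⟨r, hr⟩
    have hU : (0 : ℝ) ≤ U.card := Nat.cast_nonneg _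
    by_cases h : r = v
    · subst h
      rw [Labeling.part_replace_self] at hr
      linarith
    · rw [Labeling.part_replace_of_ne _ h] at hr
      have h1 : ((l.part r \ T) ∩ U).card ≤ (l.part r ∩ U).card :=
        Finset.card_le_card (Finset.inter_subset_inter_right Finset.sdiff_subset)
      have h2 : (l.part r ∩ U).card + (l.part v ∩ U).card ≤ U.card := by
        rw [← Finset.card_union_of_disjoint
          ((l.disjoint_part h).mono Finset.inter_subset_left Finset.inter_subset_left)]
        exact Finset.card_le_card
          (Finset.union_subset Finset.inter_subset_right Finset.inter_subset_right)
      have h1' : (((l.part r \ T) ∩ U).card : ℝ) ≤ (l.part r ∩ U).card := by exact_mod_cast h1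
      have h2' : ((l.part r ∩ U).card : ℝ) + (l.part v ∩ U).card ≤ U.card := by exact_mod_cast h2
      linarith
  have htot : (l.replace v T hT.1).total G ≤ l.total G :=
    Finset.sum_le_sum fun u _ => l.cutValue_part_replace_le v hT u
  rw [Labeling.score, Labeling.score, if_neg hno, if_pos ⟨v, hv⟩]
  linarith

lemma Labeling.part_mem_balancedIsolatingCuts {U : Finset V} {t : ℝ} {G : WeightedGraph V}
    {l : Labeling R} (hl : ∀ l' : Labeling R, l.score U t G < l'.score U t G + t) :
    l.part ∈ balancedIsolatingCuts G R U := by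
  intro v T hT hTU
  by_contra! hv
  exact (hl _).not_ge (l.score_replace_add_le t hT hTU hv)

/-- Of the error `2 * t`, one half is the penalty that the best family may carry, the other half
the suboptimality of `l`. -/
lemma Labeling.part_mem_approxIsolatingCuts {U : Finset V} {t : ℝ} (ht : 0 ≤ t)
    {G : WeightedGraph V} {l : Labeling R}
    (hl : ∀ l' : Labeling R, l.score U t G < l'.score U t G + t) :
    l.part ∈ approxIsolatingCuts G R (2 * t) := by
  intro S' hS'
  obtain ⟨l', hl'⟩ := exists_labeling_forall_le G R
  have h1 : l'.total G ≤ ∑ v : R, G.cutValue (S' v) :=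
    Finset.sum_le_sum fun v _ => hl' v _ (hS' v)
  have h2 (v : R) : G.cutValue (S' v) ≤ G.cutValue (l.part v) :=
    (hS' v).2 _ (l.isIsolating_part v)
  have h3 : ∑ v : R, (G.cutValue (l.part v) - G.cutValue (S' v)) ≤ 2 * t := by
    rw [Finset.sum_sub_distrib]
    have := l.total_le_score (U := U) ht G
    rw [Labeling.total] at this
    linarith [hl l', l'.score_le (U := U) ht G]
  constructor
  · rw [← Finset.sum_sub_distrib,
      abs_of_nonneg (Finset.sum_nonneg fun v _ => sub_nonneg.2 (h2 v))]
    exact h3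
  · intro v
    have := Finset.single_le_sum (f := fun v : R => G.cutValue (l.part v) - G.cutValue (S' v))
      (fun v _ => sub_nonneg.2 (h2 v)) (Finset.mem_univ v)
    linarith

end Labelings

/-! ### The algorithm -/

/-- With at least two terminals, a disjoint family drawn by the exponential mechanism for the score
with penalty `t`; otherwise the whole vertex set for every terminal. The parameter `ε / 4` accounts
for the sensitivity `2` of the score. -/
noncomputable def isolatingCutsMechanism {V : Type*} [Fintype V] [DecidableEq V]
    (R U : Finset V) (ε t : ℝ) : RandomizedAlgorithm (WeightedGraph V) (R → Finset V) := fun G =>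
  if R.card ≤ 1 then PMF.pure fun _ => Finset.univ
  else (expMechanism (ε / 4) (Labeling.score (R := R) U t G)).map Labeling.part

section Mechanism

variable {V : Type*} [Fintype V] [DecidableEq V]

lemma isDifferentiallyPrivate_isolatingCutsMechanism (R U : Finset V) {ε : ℝ} (hε : 0 < ε)
    (t : ℝ) : IsDifferentiallyPrivate (isolatingCutsMechanism R U ε t) ε 0 := by
  intro G G' h O
  rw [ENNReal.ofReal_zero, add_zero]
  unfold isolatingCutsMechanism
  split_ifs
  · exact le_mul_of_one_le_left' (ENNReal.one_le_ofReal.2 (Real.one_le_exp hε.le))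
  · rw [PMF.toOuterMeasure_map_apply, PMF.toOuterMeasure_map_apply]
    have := expMechanism_toOuterMeasure_le (η := ε / 4) (by positivity)
      (fun l : Labeling R => l.abs_score_sub_le h U t) (Labeling.part ⁻¹' O)
    rwa [show 2 * (ε / 4 * 2) = ε by ring] at this

lemma isIsolating_of_mem_support {R U : Finset V} {ε t : ℝ} {G : WeightedGraph V}
    {S : R → Finset V} (hS : S ∈ (isolatingCutsMechanism R U ε t G).support) (v : R) :
    IsIsolating R v (S v) := by
  unfold isolatingCutsMechanism at hS
  split_ifs at hS with hR
  · rw [PMF.support_pure, Set.mem_singleton_iff] at hS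
    subst hS
    rw [IsIsolating, Finset.univ_inter]
    exact Finset.eq_singleton_iff_unique_mem.2
      ⟨v.2, fun x hx => Finset.card_le_one.1 hR x hx v v.2⟩
  · rw [PMF.support_map] at hS
    obtain ⟨l, -, rfl⟩ := hS
    exact l.isIsolating_part v

lemma univ_mem_approxIsolatingCuts {R : Finset V} (hR : R.card ≤ 1) (G : WeightedGraph V) {err : ℝ}
    (herr : 0 ≤ err) : (fun _ => Finset.univ) ∈ approxIsolatingCuts G R err := by
  have h0 : G.cutValue Finset.univ = 0 := by simp [WeightedGraph.cutValue]
  intro S' hS'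
  have h1 (v : R) : G.cutValue (S' v) = 0 := by
    refine le_antisymm ?_ (G.cutValue_nonneg _)
    rw [← h0]
    refine (hS' v).2 _ ?_
    rw [IsIsolating, Finset.univ_inter]
    exact Finset.eq_singleton_iff_unique_mem.2
      ⟨v.2, fun x hx => Finset.card_le_one.1 hR x hx v v.2⟩
  simp [h0, h1, herr]

/-- Up to a factor `2` this is the error bound of the algorithm. -/
noncomputable def isolatingPenalty (c : ℝ) (n k : ℕ) (ε β : ℝ) : ℝ :=
  4 * (2 + c) * (((n : ℝ) + Real.logb 2 (1 / β)) * Real.logb 2 (k : ℝ) ^ 2 / ε)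

lemma isolatingPenalty_nonneg {c ε β : ℝ} (hc : 0 < c) (n k : ℕ) (hε : 0 < ε) (hβ : 0 < β)
    (hβ1 : β < 1) : 0 ≤ isolatingPenalty c n k ε β := by
  have : 0 ≤ Real.logb 2 (1 / β) :=
    Real.logb_nonneg (by norm_num) (by rw [le_div_iff₀ hβ]; linarith)
  unfold isolatingPenalty
  positivity

lemma log_le_logb_two {x : ℝ} (hx : 1 ≤ x) : Real.log x ≤ Real.logb 2 x := by
  have h2 : 0 < Real.log 2 := Real.log_pos (by norm_num)
  rw [Real.logb, le_div_iff₀ h2]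
  exact mul_le_of_le_one_right (Real.log_nonneg hx) (by linarith [Real.log_two_lt_d9])

/-- The penalty outweighs the number of labelings together with the failure probability. -/
lemma pow_mul_exp_isolatingPenalty_le {c ε β : ℝ} {n k : ℕ} (hc : 0 < c) (hε : 0 < ε)
    (hβ : 0 < β) (hβ1 : β < 1) (hk : 2 ≤ k) (hn : 1 ≤ n) :
    ((k : ℝ) + 1) ^ n * Real.exp (-(ε / 4 * isolatingPenalty c n k ε β)) ≤
      min β ((n : ℝ) ^ (-c)) := by
  have hk' : (2 : ℝ) ≤ k := by exact_mod_cast hk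
  have hn' : (1 : ℝ) ≤ n := by exact_mod_cast hn
  have hβ' : 1 ≤ 1 / β := by rw [le_div_iff₀ hβ]; linarith
  set b := Real.logb 2 (1 / β) with hb
  set L := Real.logb 2 (k : ℝ) with hL
  have hL1 : 1 ≤ L := by
    rw [hL, Real.le_logb_iff_rpow_le (by norm_num) (by linarith)]
    simpa using hk'
  have hb0 : 0 ≤ b := Real.logb_nonneg (by norm_num) hβ'
  have hbl : -Real.log β ≤ b := by
    have := log_le_logb_two hβ'
    rwa [one_div, Real.log_inv, ← one_div] at this
  have hlogn : Real.log n ≤ n := (Real.log_le_sub_one_of_pos (by linarith)).trans (by linarith)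
  have hlogn0 : 0 ≤ Real.log n := Real.log_nonneg hn'
  have hlogβ : Real.log β ≤ 0 := Real.log_nonpos hβ.le hβ1.le
  -- `k + 1 ≤ k ^ 2` since `2 ≤ k`
  have hlogk : Real.log ((k : ℝ) + 1) ≤ 2 * L := by
    calc Real.log ((k : ℝ) + 1) ≤ Real.log ((k : ℝ) ^ 2) :=
          Real.log_le_log (by positivity) (by nlinarith)
      _ = 2 * Real.log k := by rw [Real.log_pow]; norm_num
      _ ≤ 2 * L := by linarith [log_le_logb_two (x := k) (by linarith)]
  have hpen : ε / 4 * isolatingPenalty c n k ε β = (2 + c) * ((n + b) * L ^ 2) := by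
    unfold isolatingPenalty
    rw [← hb, ← hL]
    field_simp
  have hLL : L ≤ L ^ 2 := by nlinarith
  have hmain : n * Real.log ((k : ℝ) + 1) - Real.log β + c * Real.log n ≤
      (2 + c) * ((n + b) * L ^ 2) := by
    have e1 : n * Real.log ((k : ℝ) + 1) ≤ 2 * (n * L ^ 2) := by
      nlinarith [mul_le_mul_of_nonneg_left (hlogk.trans (by linarith : 2 * L ≤ 2 * L ^ 2))
        (by linarith : (0 : ℝ) ≤ n)]
    have e2 : c * Real.log n ≤ c * (n * L ^ 2) :=
      mul_le_mul_of_nonneg_left (by nlinarith) hc.le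
    have e3 : b ≤ (2 + c) * (b * L ^ 2) := by
      have : b ≤ b * L ^ 2 := le_mul_of_one_le_right hb0 (by linarith)
      nlinarith
    nlinarith
  have hpow : ((k : ℝ) + 1) ^ n = Real.exp (n * Real.log ((k : ℝ) + 1)) := by
    rw [mul_comm, Real.exp_mul, Real.exp_log (by positivity), Real.rpow_natCast]
  rw [hpen, hpow, ← Real.exp_add]
  refine le_min ?_ ?_
  · rw [← Real.le_log_iff_exp_le hβ]
    nlinarith [mul_nonneg hc.le hlogn0]
  · rw [Real.rpow_def_of_pos (by linarith)]
    apply Real.exp_le_exp.2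
    linarith

lemma ofReal_le_isolatingCutsMechanism (R U : Finset V) {c ε β : ℝ} (hc : 0 < c) (hε : 0 < ε)
    (hβ : 0 < β) (hβ1 : β < 1) (G : WeightedGraph V) :
    ENNReal.ofReal (1 - min β ((Fintype.card V : ℝ) ^ (-c))) ≤
      (isolatingCutsMechanism R U ε (isolatingPenalty c (Fintype.card V) R.card ε β)
        G).toOuterMeasure
        {S | S ∈ approxIsolatingCuts G R
            (2 * isolatingPenalty c (Fintype.card V) R.card ε β) ∧
          (2 ≤ R.card → S ∈ balancedIsolatingCuts G R U)} := by
  set t := isolatingPenalty c (Fintype.card V) R.card ε β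
  have ht : 0 ≤ t := isolatingPenalty_nonneg hc _ _ hε hβ hβ1
  unfold isolatingCutsMechanism
  split_ifs with hR
  · rw [PMF.toOuterMeasure_pure_apply, if_pos]
    · rw [ENNReal.ofReal_le_one]
      have : 0 ≤ min β ((Fintype.card V : ℝ) ^ (-c)) := le_min hβ.le (by positivity)
      linarith
    · exact ⟨univ_mem_approxIsolatingCuts hR G (by positivity), fun h => by omega⟩
  · rw [PMF.toOuterMeasure_map_apply]
    obtain ⟨l₀, hl₀⟩ := Finite.exists_min (Labeling.score (R := R) U t G)
    have hcard : (Fintype.card (Labeling R) : ℝ) ≤ ((R.card : ℝ) + 1) ^ Fintype.card V := by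
      exact_mod_cast card_labeling_le (R := R)
    have hn : 1 ≤ Fintype.card V := by
      have := R.card_le_univ
      omega
    refine (ofReal_le_expMechanism (t := t) (by positivity) (Labeling.score U t G) l₀
      ((mul_le_mul_of_nonneg_right hcard
      (Real.exp_pos _).le).trans (pow_mul_exp_isolatingPenalty_le hc hε hβ hβ1
        (by omega) hn))).trans ?_
    refine MeasureTheory.measure_mono fun l hl => ?_
    have hl' (l' : Labeling R) : l.score U t G < l'.score U t G + t :=
      lt_of_lt_of_le hl (by linarith [hl₀ l'])
    exact ⟨Labeling.part_mem_approxIsolatingCuts ht hl',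
      fun _ => Labeling.part_mem_balancedIsolatingCuts hl'⟩

end Mechanism

theorem theorem1p3 (c : ℝ) (hc : 0 < c) :
    ∃ C : ℝ, 0 < C ∧
    ∃ isoCuts : ∀ (V : Type u) [Fintype V] [DecidableEq V] (R _U : Finset V) (_ε _β : ℝ),
        RandomizedAlgorithm (WeightedGraph V) (R → Finset V),
      ∀ (V : Type u) [Fintype V] [DecidableEq V] (R U : Finset V) (ε β : ℝ),
        0 < ε → 0 < β → β < 1 →
        IsDifferentiallyPrivate (isoCuts V R U ε β) ε 0 ∧
        ∀ G : WeightedGraph V,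
          (∀ S ∈ (isoCuts V R U ε β G).support, ∀ v : R, IsIsolating R v (S v)) ∧
          ENNReal.ofReal (1 - min β ((Fintype.card V : ℝ) ^ (-c))) ≤
            (isoCuts V R U ε β G).toOuterMeasure
              {S | S ∈ approxIsolatingCuts G R
                    (C * (((Fintype.card V : ℝ) + Real.logb 2 (1 / β)) *
                      Real.logb 2 (R.card : ℝ) ^ 2 / ε)) ∧
                  (2 ≤ R.card → S ∈ balancedIsolatingCuts G R U)} := by
  refine ⟨8 * (2 + c), by positivity, fun V _ _ R U ε β =>
    isolatingCutsMechanism R U ε (isolatingPenalty c (Fintype.card V) R.card ε β), ?_⟩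
  intro V _ _ R U ε β hε hβ hβ1
  refine ⟨isDifferentiallyPrivate_isolatingCutsMechanism R U hε _, fun G =>
    ⟨fun S hS v => isIsolating_of_mem_support hS v, ?_⟩⟩
  have h := ofReal_le_isolatingCutsMechanism R U hc hε hβ hβ1 G
  have herr : 2 * isolatingPenalty c (Fintype.card V) R.card ε β =
      8 * (2 + c) * (((Fintype.card V : ℝ) + Real.logb 2 (1 / β)) *
        Real.logb 2 (R.card : ℝ) ^ 2 / ε) := by
    unfold isolatingPenalty
    ring
  rwa [herr] at h
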